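/- For a permutation $\sigma\in\mathfrak S_n$, an index $i\in\{1,\dots,n\}$ is a cycle valley (cval) if $\sigma^{-1}(i)>i<\sigma(i)$, a cycle peak (cpeak) if $\sigma^{-1}(i)<i>\sigma(i)$, a cycle double fall (cdfall) if $\sigma^{-1}(i)>i>\sigma(i)$, a cycle double rise (cdrise) if $\sigma^{-1}(i)<i<\sigma(i)$, and a fixed point (fix) if $\sigma(i)=i$. Put $$\begin{aligned} \mathrm{ucross}(j,\sigma)&=\#\{i<j<k<l:\ k=\sigma(i),\ l=\sigma(j)\}, & \mathrm{unest}(j,\sigma)&=\#\{i<j<k<l:\ k=\sigma(j),\ l=\sigma(i)\},\\ \mathrm{lcross}(k,\sigma)&=\#\{i<j<k<l:\ i=\sigma(k),\ j=\sigma(l)\}, & \mathrm{lnest}(k,\sigma)&=\#\{i<j<k<l:\ i=\sigma(l),\ j=\sigma(k)\}, \end{aligned}$$ where in each case the index appearing as an argument is held fixed, and for a fixed point $j$ let $\mathrm{lev}(j,\sigma)=\#\{i<j:\ \sigma(i)>j\}$. **Theorem (First master J-fraction for permutations).** Let $\mathsf a=(\mathsf a_{\ell,\ell'})_{\ell,\ell'\ge0}$,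 $\mathsf b=(\mathsf b_{\ell,\ell'})_{\ell,\ell'\ge0}$, $\mathsf c=(\mathsf c_{\ell,\ell'})_{\ell,\ell'\ge0}$, $\mathsf d=(\mathsf d_{\ell,\ell'})_{\ell,\ell'\ge0}$, $\mathsf e=(\mathsf e_\ell)_{\ell\ge0}$ be indeterminates (or, equivalently, arbitrary elements of an arbitrary commutative ring), and for $n\ge 0$ let $$Q_n(\mathsf a,\mathsf b,\mathsf c,\mathsf d,\mathsf e)=\sum_{\sigma\in\mathfrak S_n}\ \prod_{i\in\mathrm{cval}}\mathsf a_{\mathrm{ucross}(i,\sigma),\,\mathrm{unest}(i,\sigma)}\prod_{i\in\mathrm{cpeak}}\mathsf b_{\mathrm{lcross}(i,\sigma),\,\mathrm{lnest}(i,\sigma)}\prod_{i\in\mathrm{cdfall}}\mathsf c_{\mathrm{lcross}(i,\sigma),\,\mathrm{lnest}(i,\sigma)}\prod_{i\in\mathrm{cdrise}}\mathsf d_{\mathrm{ucross}(i,\sigma),\,\mathrm{unest}(i,\sigma)}\prod_{i\in\mathrm{fix}}\mathsf e_{\mathrm{lev}(i,\sigma)}.$$ Then, as formal power series in $t$, $$\sum_{n=0}^\infty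 Q_n(\mathsf a,\mathsf b,\mathsf c,\mathsf d,\mathsf e)\,t^n=\cfrac{1}{1-\gamma_0t-\cfrac{\beta_1t^2}{1-\gamma_1t-\cfrac{\beta_2t^2}{1-\cdots}}},$$ where $$\gamma_n=\mathsf c^\star_{n-1}+\mathsf d^\star_{n-1}+\mathsf e_n\quad(n\ge0),\qquad \beta_n=\mathsf a^\star_{n-1}\,\mathsf b^\star_{n-1}\quad(n\ge1),\qquad \mathsf a^\star_{n-1}=\sum_{\ell=0}^{n-1}\mathsf a_{\ell,\,n-1-\ell},$$ with $\mathsf b^\star,\mathsf c^\star,\mathsf d^\star$ defined in the same way (so $\mathsf c^\star_{-1}=\mathsf d^\star_{-1}=0$ and $\gamma_0=\mathsf e_0$). The infinite continued fraction is the coefficientwise limit of its finite truncations. -/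

import Mathlib

namespace PermJFrac

section Statistics

variable {n : ℕ}

/-- `i` is a cycle peak of `σ`. -/
def IsCPeak (σ : Equiv.Perm (Fin n)) (i : Fin n) : Prop := σ⁻¹ i < i ∧ σ i < i

/-- `i` is a cycle valley of `σ`. -/
def IsCVal (σ : Equiv.Perm (Fin n)) (i : Fin n) : Prop := i < σ⁻¹ i ∧ i < σ i

/-- `i` is a cycle double rise of `σ`. -/
def IsCDRise (σ : Equiv.Perm (Fin n)) (i : Fin n) : Prop := σ⁻¹ i < i ∧ i < σ i

/-- `i` is a cycle double fall of `σ`. -/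
def IsCDFall (σ : Equiv.Perm (Fin n)) (i : Fin n) : Prop := i < σ⁻¹ i ∧ σ i < i

/-- `i` is a fixed point of `σ`. -/
def IsFix (σ : Equiv.Perm (Fin n)) (i : Fin n) : Prop := σ i = i

instance (σ : Equiv.Perm (Fin n)) : DecidablePred (IsCPeak σ) :=
  fun _ => inferInstanceAs (Decidable (_ ∧ _))
instance (σ : Equiv.Perm (Fin n)) : DecidablePred (IsCVal σ) :=
  fun _ => inferInstanceAs (Decidable (_ ∧ _))
instance (σ : Equiv.Perm (Fin n)) : DecidablePred (IsCDRise σ) :=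
  fun _ => inferInstanceAs (Decidable (_ ∧ _))
instance (σ : Equiv.Perm (Fin n)) : DecidablePred (IsCDFall σ) :=
  fun _ => inferInstanceAs (Decidable (_ ∧ _))
instance (σ : Equiv.Perm (Fin n)) : DecidablePred (IsFix σ) :=
  fun _ => inferInstanceAs (Decidable (_ = _))

/-- Number of upper crossings `i < j < k < l`, `k = σ i`, `l = σ j`, with the given `j` in
second position. The triple `p` is `(i, k, l)`. -/
def ucross (j : Fin n) (σ : Equiv.Perm (Fin n)) : ℕ :=
  (Finset.univ.filter fun p : Fin n × Fin n × Fin n =>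
    (p.1 < j ∧ j < p.2.1 ∧ p.2.1 < p.2.2) ∧ p.2.1 = σ p.1 ∧ p.2.2 = σ j).card

/-- Number of upper nestings `i < j < k < l`, `k = σ j`, `l = σ i`, with the given `j` in
second position. The triple `p` is `(i, k, l)`. -/
def unest (j : Fin n) (σ : Equiv.Perm (Fin n)) : ℕ :=
  (Finset.univ.filter fun p : Fin n × Fin n × Fin n =>
    (p.1 < j ∧ j < p.2.1 ∧ p.2.1 < p.2.2) ∧ p.2.1 = σ j ∧ p.2.2 = σ p.1).card

/-- Number of lower crossings `i < j < k < l`, `i = σ k`, `j = σ l`, with the given `k` in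
third position. The triple `p` is `(i, j, l)`. -/
def lcross (k : Fin n) (σ : Equiv.Perm (Fin n)) : ℕ :=
  (Finset.univ.filter fun p : Fin n × Fin n × Fin n =>
    (p.1 < p.2.1 ∧ p.2.1 < k ∧ k < p.2.2) ∧ p.1 = σ k ∧ p.2.1 = σ p.2.2).card

/-- Number of lower nestings `i < j < k < l`, `i = σ l`, `j = σ k`, with the given `k` in
third position. The triple `p` is `(i, j, l)`. -/
def lnest (k : Fin n) (σ : Equiv.Perm (Fin n)) : ℕ :=
  (Finset.univ.filter fun p : Fin n × Fin n × Fin n =>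
    (p.1 < p.2.1 ∧ p.2.1 < k ∧ k < p.2.2) ∧ p.1 = σ p.2.2 ∧ p.2.1 = σ k).card

/-- Level of a fixed point `j`: the number of `i < j` with `σ i > j`. -/
def lev (j : Fin n) (σ : Equiv.Perm (Fin n)) : ℕ :=
  (Finset.univ.filter fun i : Fin n => i < j ∧ j < σ i).card

end Statistics

/-- The master polynomial `Q_n(a, b, c, d, e)`. -/
def Q {R : Type*} [CommRing R] (a b c d : ℕ → ℕ → R) (e : ℕ → R) (n : ℕ) : R :=
  ∑ σ : Equiv.Perm (Fin n),
    (∏ i with IsCVal σ i, a (ucross i σ) (unest i σ)) *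
    (∏ i with IsCPeak σ i, b (lcross i σ) (lnest i σ)) *
    (∏ i with IsCDFall σ i, c (lcross i σ) (lnest i σ)) *
    (∏ i with IsCDRise σ i, d (ucross i σ) (unest i σ)) *
    (∏ i with IsFix σ i, e (lev i σ))

/-- `starPred a n` is `a⋆_{n-1} = ∑_{ℓ=0}^{n-1} a_{ℓ, n-1-ℓ}`; it is the empty sum for `n = 0`. -/
def starPred {R : Type*} [CommRing R] (a : ℕ → ℕ → R) (n : ℕ) : R :=
  ∑ ℓ ∈ Finset.range n, a ℓ (n - 1 - ℓ)

/-- The finite continued fraction with `N` levels, starting at level `k`,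
`1 / (1 - γ_k t - β_{k+1} t² / (1 - γ_{k+1} t - ⋯ - β_{k+N-1} t² / (1 - γ_{k+N-1} t)))`,
as a formal power series in `t` (every denominator has constant term `1`). -/
noncomputable def jConvergent {R : Type*} [CommRing R] (γ β : ℕ → R) :
    ℕ → ℕ → PowerSeries R
  | 0, _ => 0
  | N + 1, k =>
      PowerSeries.invOfUnit
        (1 - PowerSeries.C (γ k) * PowerSeries.X
          - PowerSeries.C (β (k + 1)) * PowerSeries.X ^ 2 * jConvergent γ β N (k + 1)) 1

/-- `f` is the J-type continued fraction
`1 / (1 - γ_0 t - β_1 t² / (1 - γ_1 t - β_2 t² / (1 - ⋯)))`: its finite truncations converge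
to `f` as formal power series, i.e. each coefficient is eventually that of `f`.
The value `β 0` is not used. -/
def IsJFraction {R : Type*} [CommRing R] (f : PowerSeries R) (γ β : ℕ → R) : Prop :=
  ∀ m : ℕ, ∀ᶠ N in Filter.atTop,
    PowerSeries.coeff m (jConvergent γ β N 0) = PowerSeries.coeff m f

end PermJFrac

/-!
Cut a permutation `σ` of `{0, …, n - 1}` before each position `k`. As many arcs `i ↦ σ i` go up
across the cut as go down; call this number the height. From one cut to the next the height rises
by one at a cycle valley, falls by one at a cycle peak and otherwise stays, so the heights form a
Motzkin path. At an index `k` with `k < σ k` the numbers `ucross` and `unest` add up to the number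
of arcs that go up over `k` from an earlier position, and at an index with `σ k < k` the numbers
`lcross` and `lnest` add up to the number of arcs that go down over `k` from a later one. Hence the
height determines the sum of the two (and the level of a fixed point), and each index contributes
one of the steps in `Step.allowed`. The sequence of all steps is a *Laguerre history*
(`history_mem`).

A permutation can be recovered from its history: the arcs going down from left to right, the arcs
going up from right to left, each by the rank of its end point among those that are still free
(`eq_of_card_nesting_eq`, `history_injective`). Surjectivity needs no decoding: by
`sum_histories` the number of histories satisfies the recursion for weighted Motzkin paths with all
indeterminates equal to one, whose solution is `m! * choose m h`, so there are `n!` histories from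
height `0` (`card_histories`). Therefore `Q` is a sum over histories, which is a sum over Motzkin
paths with the starred sums as weights (`Q_eq_motzkin`), and Flajolet's theorem
(`isJFraction_motzkin`) expresses their generating function as a continued fraction.
-/

open Finset

namespace PermJFrac

/-! ### Continued fractions and weighted Motzkin paths -/

section Flajolet

variable {R : Type*} [CommRing R]

/-- The total weight of the Motzkin paths with `m` steps from height `h` down to height `0`, where
a level step at height `h` weighs `γ h`, a rise from `h` to `h + 1` weighs `A h` and a fall from
`h` to `h - 1` weighs `B h`. This is the right notion only when `B 0 = 0`, since `0 - 1 = 0`. -/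
def motzkin (γ A B : ℕ → R) : ℕ → ℕ → R
  | 0, h => if h = 0 then 1 else 0
  | m + 1, h => γ h * motzkin γ A B m h + A h * motzkin γ A B m (h + 1)
      + B h * motzkin γ A B m (h - 1)

theorem jConvergent_succ_mul (γ β : ℕ → R) (N k : ℕ) :
    jConvergent γ β (N + 1) k *
      (1 - PowerSeries.C (γ k) * PowerSeries.X
        - PowerSeries.C (β (k + 1)) * PowerSeries.X ^ 2 * jConvergent γ β N (k + 1)) = 1 := by
  rw [jConvergent]
  exact PowerSeries.invOfUnit_mul _ 1 (by simp)

/-- The generating function of the weighted paths from height `h` to height `0` that stay below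
height `N`, as a product: such a path is cut at its first falls to `h - 1`, `h - 2`, …, `0`, and
the convergent at level `i` accounts for the piece that stays at or above height `i`. -/
noncomputable def pathSeries (γ β B : ℕ → R) (N h : ℕ) : PowerSeries R :=
  (∏ i ∈ range h, jConvergent γ β (N - i) i * (PowerSeries.C (B (i + 1)) * PowerSeries.X)) *
    jConvergent γ β (N - h) h

theorem pathSeries_eq {γ β A B : ℕ → R} (hB : B 0 = 0) (hβ : ∀ h, β (h + 1) = A h * B (h + 1))
    {N h : ℕ} (hh : h < N) :
    pathSeries γ β B N h = (if h = 0 then 1 else 0) + PowerSeries.X *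
      (PowerSeries.C (γ h) * pathSeries γ β B N h
        + PowerSeries.C (A h) * pathSeries γ β B N (h + 1)
        + PowerSeries.C (B h) * pathSeries γ β B N (h - 1)) := by
  obtain ⟨M, rfl⟩ : ∃ M, N = h + M + 1 := ⟨N - h - 1, by omega⟩
  have key := jConvergent_succ_mul γ β M h
  have e1 : h + M + 1 - h = M + 1 := by omega
  have e2 : h + M + 1 - (h + 1) = M := by omega
  rw [hβ, map_mul] at key
  -- The fall from `h` to `h - 1` is the last factor of the prefactor, which is empty if `h = 0`.
  have prefactor : (∏ i ∈ range h, jConvergent γ β (h + M + 1 - i) i *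
      (PowerSeries.C (B (i + 1)) * PowerSeries.X)) = (if h = 0 then 1 else 0) +
      PowerSeries.X * PowerSeries.C (B h) * pathSeries γ β B (h + M + 1) (h - 1) := by
    rcases h with _ | h
    · simp [hB]
    · simp only [pathSeries, prod_range_succ, Nat.add_sub_cancel, Nat.succ_ne_zero, if_false]
      ring
  have next : pathSeries γ β B (h + M + 1) (h + 1) =
      (∏ i ∈ range h, jConvergent γ β (h + M + 1 - i) i *
        (PowerSeries.C (B (i + 1)) * PowerSeries.X)) *
      (jConvergent γ β (M + 1) h * (PowerSeries.C (B (h + 1)) * PowerSeries.X)) *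
      jConvergent γ β M (h + 1) := by
    simp only [pathSeries, prod_range_succ, e1, e2]
  have here : pathSeries γ β B (h + M + 1) h =
      (∏ i ∈ range h, jConvergent γ β (h + M + 1 - i) i *
        (PowerSeries.C (B (i + 1)) * PowerSeries.X)) * jConvergent γ β (M + 1) h := by
    simp only [pathSeries, e1]
  rw [next, here]
  linear_combination (∏ i ∈ range h, jConvergent γ β (h + M + 1 - i) i *
        (PowerSeries.C (B (i + 1)) * PowerSeries.X)) * key + prefactor

theorem coeff_pathSeries {γ β A B : ℕ → R} (hB : B 0 = 0)
    (hβ : ∀ h, β (h + 1) = A h * B (h + 1)) {N : ℕ} (m : ℕ) :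
    ∀ h, h + m < N → PowerSeries.coeff m (pathSeries γ β B N h) = motzkin γ A B m h := by
  induction m with
  | zero =>
    intro h hh
    rw [pathSeries_eq hB hβ (by omega)]
    split_ifs with h0 <;> simp [motzkin, h0]
  | succ m ih =>
    intro h hh
    rw [pathSeries_eq hB hβ (by omega), motzkin, ← ih h (by omega), ← ih (h + 1) (by omega),
      ← ih (h - 1) (by omega)]
    have : PowerSeries.coeff (m + 1) (if h = 0 then 1 else 0 : PowerSeries R) = 0 := by
      split_ifs <;> simp [PowerSeries.coeff_one]
    simp only [map_add, this, zero_add, PowerSeries.coeff_succ_X_mul, PowerSeries.coeff_C_mul]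

/-- **Flajolet's theorem**: the generating function of weighted Motzkin paths is a J-fraction. -/
theorem isJFraction_motzkin {γ β A B : ℕ → R} (hB : B 0 = 0)
    (hβ : ∀ h, β (h + 1) = A h * B (h + 1)) :
    IsJFraction (PowerSeries.mk fun n => motzkin γ A B n 0) γ β := by
  intro m
  filter_upwards [Filter.eventually_gt_atTop m] with N hN
  have := coeff_pathSeries (γ := γ) hB hβ m 0 (by simpa using hN)
  simpa [pathSeries] using this

end Flajolet

/-! ### Laguerre histories -/

/-- A step of a Laguerre history: the kind of an index of a permutation, together with its numbers
of crossings and nestings, or with its level if it is a fixed point. -/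
inductive Step where
  | valley (p : ℕ × ℕ)
  | peak (p : ℕ × ℕ)
  | fall (p : ℕ × ℕ)
  | rise (p : ℕ × ℕ)
  | fixed (l : ℕ)
  deriving DecidableEq

namespace Step

/-- The height reached from height `h` after a step. -/
def next (h : ℕ) : Step → ℕ
  | valley _ => h + 1
  | peak _ => h - 1
  | _ => h

/-- The factor of the master polynomial that a step contributes. -/
def weight {R : Type*} (a b c d : ℕ → ℕ → R) (e : ℕ → R) : Step → R
  | valley p => a p.1 p.2
  | peak p => b p.1 p.2
  | fall p => c p.1 p.2
  | rise p => d p.1 p.2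
  | fixed l => e l

/-- The pairs of natural numbers with sum `h - 1`; there are none for `h = 0`. -/
def pairs (h : ℕ) : Finset (ℕ × ℕ) :=
  (range h).image fun l => (l, h - 1 - l)

theorem mem_pairs {h : ℕ} {p : ℕ × ℕ} : p ∈ pairs h ↔ p.1 + p.2 + 1 = h := by
  obtain ⟨x, y⟩ := p
  simp only [pairs, mem_image, mem_range, Prod.mk.injEq]
  constructor
  · rintro ⟨l, hl, rfl, rfl⟩
    omega
  · rintro rfl
    exact ⟨x, by omega, rfl, by omega⟩

theorem sum_pairs {R : Type*} [CommRing R] (f : ℕ → ℕ → R) (h : ℕ) :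
    ∑ p ∈ pairs h, f p.1 p.2 = starPred f h := by
  rw [pairs, sum_image fun x _ y _ hxy => congrArg Prod.fst hxy, starPred]

/-- The steps that a history may take at height `h`. -/
def allowed (h : ℕ) : Finset Step :=
  (pairs (h + 1)).image valley ∪ ((pairs h).image peak ∪ ((pairs h).image fall ∪
    ((pairs h).image rise ∪ {fixed h})))

theorem sum_allowed {M : Type*} [AddCommMonoid M] (f : Step → M) (h : ℕ) :
    ∑ s ∈ allowed h, f s = ∑ p ∈ pairs (h + 1), f (valley p) + (∑ p ∈ pairs h, f (peak p) +
      (∑ p ∈ pairs h, f (fall p) + (∑ p ∈ pairs h, f (rise p) + f (fixed h)))) := by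
  rw [allowed, sum_union, sum_union, sum_union, sum_union, sum_singleton]
  · rw [sum_image, sum_image, sum_image, sum_image] <;> simp [Set.InjOn]
  all_goals
    rw [disjoint_left]
    simp only [mem_image, mem_union, mem_singleton]
    rintro _ ⟨p, -, rfl⟩
    simp

end Step

/-- The Laguerre histories with `m` steps from height `h` to height `0`. -/
def histories : ℕ → ℕ → Finset (List Step)
  | 0, h => if h = 0 then {[]} else ∅
  | m + 1, h => (Step.allowed h).biUnion fun s => (histories m (s.next h)).image (List.cons s)

theorem sum_histories_succ {M : Type*} [AddCommMonoid M] (f : List Step → M) (m h : ℕ) :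
    ∑ w ∈ histories (m + 1) h, f w =
      ∑ s ∈ Step.allowed h, ∑ w ∈ histories m (s.next h), f (s :: w) := by
  rw [histories, sum_biUnion]
  · refine sum_congr rfl fun s _ => ?_
    rw [sum_image]
    simp [Set.InjOn]
  · intro s _ t _ hst
    simp only [Function.onFun, disjoint_left, mem_image]
    rintro _ ⟨w, -, rfl⟩ ⟨w', -, h'⟩
    exact hst (List.cons.inj h').1.symm

/-- Adding up the choices of the pairs in a history leaves a weighted Motzkin path. -/
theorem sum_histories {R : Type*} [CommRing R] (a b c d : ℕ → ℕ → R) (e : ℕ → R) (m : ℕ) :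
    ∀ h, ∑ w ∈ histories m h, (w.map (Step.weight a b c d e)).prod =
      motzkin (fun n => starPred c n + starPred d n + e n) (fun n => starPred a (n + 1))
        (starPred b) m h := by
  induction m with
  | zero =>
    intro h
    rw [histories, motzkin]
    split_ifs <;> simp
  | succ m ih =>
    intro h
    rw [sum_histories_succ]
    simp only [List.map_cons, List.prod_cons, ← mul_sum, ih, Step.sum_allowed, Step.weight,
      Step.next, ← sum_mul, Step.sum_pairs, motzkin]
    ring

/-- There are as many Laguerre histories of length `n` from `0` to `0` as permutations. -/
theorem card_histories (m : ℕ) : #(histories m 0) = m.factorial := by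
  have hone (k : ℕ) : starPred (fun _ _ => (1 : ℤ)) k = k := by simp [starPred]
  -- Starting at height `h` there are `m! * choose m h` histories, which satisfies the recursion.
  have key : ∀ h, motzkin (fun n => starPred (fun _ _ => (1 : ℤ)) n
      + starPred (fun _ _ => (1 : ℤ)) n + 1) (fun n => starPred (fun _ _ => (1 : ℤ)) (n + 1))
      (starPred fun _ _ => (1 : ℤ)) m h = (m.factorial * m.choose h : ℕ) := by
    induction m with
    | zero =>
      intro h
      rcases h with _ | h <;> simp [motzkin]
    | succ m ih =>
      intro h
      rw [motzkin, ih, ih, ih, hone, hone]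
      rcases h with _ | h
      · simp [Nat.factorial_succ]
        ring
      · have h2 := Nat.choose_succ_right_eq m (h + 1)
        have h3 := Nat.choose_succ_right_eq m h
        have h4 := Nat.choose_succ_succ m h
        rcases lt_or_ge m h with hm | hm
        · simp [Nat.choose_eq_zero_of_lt hm, Nat.choose_eq_zero_of_lt (show m < h + 1 by omega),
            Nat.choose_eq_zero_of_lt (show m < h + 1 + 1 by omega),
            Nat.choose_eq_zero_of_lt (show m + 1 < h + 1 by omega)]
        · have e2 : ((m.choose (h + 2) : ℕ) : ℤ) * (h + 2) = m.choose (h + 1) * (m - (h + 1)) := by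
            rcases hm.lt_or_eq with hm' | rfl
            · have := congrArg (Nat.cast (R := ℤ)) h2
              push_cast [Nat.cast_sub (show h + 1 ≤ m by omega)] at this
              linarith
            · simp [Nat.choose_eq_zero_of_lt (show h < h + 2 by omega)]
          have e3 : ((m.choose (h + 1) : ℕ) : ℤ) * (h + 1) = m.choose h * (m - h) := by
            have := congrArg (Nat.cast (R := ℤ)) h3
            push_cast [Nat.cast_sub hm] at this
            linarith
          simp only [Nat.succ_eq_add_one] at h4
          rw [Nat.factorial_succ, h4]
          push_cast
          linear_combination (m.factorial : ℤ) * e2 + (m.factorial : ℤ) * e3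
  have := sum_histories (fun _ _ => (1 : ℤ)) (fun _ _ => 1) (fun _ _ => 1) (fun _ _ => 1)
    (fun _ => 1) m 0
  rw [key 0] at this
  have hw : Step.weight (fun _ _ => (1 : ℤ)) (fun _ _ => 1) (fun _ _ => 1) (fun _ _ => 1)
      (fun _ => 1) = fun _ => 1 := by
    funext s
    cases s <;> rfl
  rw [hw] at this
  simp only [List.map_const', List.prod_replicate, one_pow, sum_const, nsmul_one,
    Nat.choose_zero_right, mul_one] at this
  exact_mod_cast this

/-! ### The statistics of a permutation -/

section Statistics

variable {n : ℕ} (σ : Equiv.Perm (Fin n))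

theorem ucross_eq (j : Fin n) :
    ucross j σ = #{i | i < j ∧ j < σ i ∧ σ i < σ j} := by
  refine card_nbij' (fun p => p.1) (fun i => (i, σ i, σ j)) ?_ ?_ ?_ ?_
  · rintro ⟨i, k, l⟩ h
    simp only [coe_filter, mem_univ, true_and, Set.mem_ofPred_eq] at h ⊢
    grind
  · intro i
    simp +contextual
  · rintro ⟨i, k, l⟩
    simp +contextual
  · intro i
    simp

theorem unest_eq {j : Fin n} (hj : j < σ j) :
    unest j σ = #{i | i < j ∧ σ j < σ i} := by
  refine card_nbij' (fun p => p.1) (fun i => (i, σ j, σ i)) ?_ ?_ ?_ ?_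
  · rintro ⟨i, k, l⟩ h
    simp only [coe_filter, mem_univ, true_and, Set.mem_ofPred_eq] at h ⊢
    grind
  · intro i
    simp +contextual [hj]
  · rintro ⟨i, k, l⟩
    simp +contextual
  · intro i
    simp

theorem lcross_eq (k : Fin n) :
    lcross k σ = #{l | k < l ∧ σ k < σ l ∧ σ l < k} := by
  refine card_nbij' (fun p => p.2.2) (fun l => (σ k, σ l, l)) ?_ ?_ ?_ ?_
  · rintro ⟨i, j, l⟩ h
    simp only [coe_filter, mem_univ, true_and, Set.mem_ofPred_eq] at h ⊢
    grind
  · intro l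
    simp +contextual
  · rintro ⟨i, j, l⟩
    simp +contextual
  · intro l
    simp

theorem lnest_eq {k : Fin n} (hk : σ k < k) :
    lnest k σ = #{l | k < l ∧ σ l < σ k} := by
  refine card_nbij' (fun p => p.2.2) (fun l => (σ l, σ k, l)) ?_ ?_ ?_ ?_
  · rintro ⟨i, j, l⟩ h
    simp only [coe_filter, mem_univ, true_and, Set.mem_ofPred_eq] at h ⊢
    grind
  · intro l
    simp +contextual [hk]
  · rintro ⟨i, j, l⟩
    simp +contextual
  · intro l
    simp

theorem ucross_add_unest {j : Fin n} (hj : j < σ j) : ucross j σ + unest j σ = lev j σ := by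
  rw [ucross_eq, unest_eq σ hj, lev, ← card_union_of_disjoint]
  · congr 1
    ext i
    have : i < j → σ i ≠ σ j := fun h h' => h.ne (σ.injective h')
    simp only [mem_union, mem_filter, mem_univ, true_and]
    grind
  · rw [disjoint_left]
    intro i
    simp only [mem_filter, mem_univ, true_and]
    grind

/-- The number of arcs `i ↦ σ i` that go up across the cut before the position `k`. -/
def height (k : ℕ) : ℕ := #{i : Fin n | (i : ℕ) < k ∧ k ≤ (σ i : ℕ)}

/-- As many arcs go down across a cut as go up. -/
theorem height_eq_down (k : ℕ) : height σ k = #{i : Fin n | k ≤ (i : ℕ) ∧ (σ i : ℕ) < k} := by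
  have h1 : #{i : Fin n | (i : ℕ) < k} = #{i : Fin n | (σ i : ℕ) < k} := by
    refine (card_equiv σ fun i => ?_).symm
    simp
  have h2 := card_sdiff_comm h1
  rw [height]
  convert h2 using 2 <;> ext i <;> simp [and_comm]
theorem lcross_add_lnest {k : Fin n} (hk : σ k < k) :
    lcross k σ + lnest k σ + 1 = height σ k := by
  rw [height_eq_down, lcross_eq, lnest_eq σ hk, ← card_union_of_disjoint,
    ← card_insert_of_notMem (a := k)]
  · congr 1
    ext i
    have : k < i → σ i ≠ σ k := fun h h' => h.ne' (σ.injective h')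
    simp only [mem_union, mem_filter, mem_univ, true_and, mem_insert, ← Fin.lt_def, ← Fin.le_def]
    grind
  · simp
  · rw [disjoint_left]
    intro i
    simp only [mem_filter, mem_univ, true_and]
    grind

theorem height_eq (k : Fin n) : height σ k = lev k σ + if σ⁻¹ k < k then 1 else 0 := by
  split_ifs with h
  · rw [lev, height, ← card_insert_of_notMem (a := σ⁻¹ k)]
    · congr 1
      ext i
      have : i = σ⁻¹ k ↔ k = σ i := by rw [Equiv.Perm.eq_inv_iff_eq, eq_comm]
      simp only [mem_filter, mem_univ, true_and, mem_insert, ← Fin.lt_def, ← Fin.le_def]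
      grind
    · simp
  · rw [lev, height, add_zero]
    congr 1
    ext i
    have : i = σ⁻¹ k ↔ k = σ i := by rw [Equiv.Perm.eq_inv_iff_eq, eq_comm]
    simp only [mem_filter, mem_univ, true_and, ← Fin.lt_def, ← Fin.le_def]
    grind

theorem height_succ (k : Fin n) : height σ (k + 1) = lev k σ + if k < σ k then 1 else 0 := by
  have hlt (i : Fin n) : (i : ℕ) < k + 1 ↔ i ≤ k := by rw [Fin.le_def]; omega
  have hle (i : Fin n) : (k : ℕ) + 1 ≤ i ↔ k < i := by rw [Fin.lt_def]; omega
  simp only [height, hlt, hle]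
  split_ifs with h
  · rw [lev, ← card_insert_of_notMem (a := k)]
    · congr 1
      ext i
      simp only [mem_filter, mem_univ, true_and, mem_insert]
      grind
    · simp
  · rw [lev, add_zero]
    congr 1
    ext i
    simp only [mem_filter, mem_univ, true_and]
    grind

theorem height_zero : height σ 0 = 0 := by simp [height]

theorem height_last : height σ n = 0 := by
  simp [height, filter_eq_empty_iff]

end Statistics

/-! ### The encoding of permutations by histories -/

section Encoding

variable {n : ℕ} (σ : Equiv.Perm (Fin n))

/-- The step that an index of a permutation contributes to its history. -/
def stepAt (i : Fin n) : Step :=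
  if IsCVal σ i then .valley (ucross i σ, unest i σ)
  else if IsCPeak σ i then .peak (lcross i σ, lnest i σ)
  else if IsCDFall σ i then .fall (lcross i σ, lnest i σ)
  else if IsCDRise σ i then .rise (ucross i σ, unest i σ)
  else .fixed (lev i σ)

theorem isFix_iff (i : Fin n) : IsFix σ i ↔ σ⁻¹ i = i := by
  rw [IsFix, Equiv.Perm.inv_eq_iff_eq, eq_comm]

/-- The five kinds of indices are exhaustive and mutually exclusive; each determines the step. -/
theorem stepAt_cases (i : Fin n) :
    ((i < σ⁻¹ i ∧ i < σ i) ∧ stepAt σ i = .valley (ucross i σ, unest i σ)) ∨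
    ((σ⁻¹ i < i ∧ σ i < i) ∧ stepAt σ i = .peak (lcross i σ, lnest i σ)) ∨
    ((i < σ⁻¹ i ∧ σ i < i) ∧ stepAt σ i = .fall (lcross i σ, lnest i σ)) ∨
    ((σ⁻¹ i < i ∧ i < σ i) ∧ stepAt σ i = .rise (ucross i σ, unest i σ)) ∨
    ((σ⁻¹ i = i ∧ σ i = i) ∧ stepAt σ i = .fixed (lev i σ)) := by
  have hfix := isFix_iff σ i
  simp only [stepAt, IsCVal, IsCPeak, IsCDFall, IsCDRise, IsFix] at hfix ⊢
  rcases lt_trichotomy (σ⁻¹ i) i with h1 | h1 | h1 <;>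
  rcases lt_trichotomy (σ i) i with h2 | h2 | h2 <;>
  grind

theorem stepAt_mem_allowed (i : Fin n) : stepAt σ i ∈ Step.allowed (height σ i) := by
  have hh := height_eq σ i
  rcases stepAt_cases σ i with ⟨⟨h1, h2⟩, hs⟩ | ⟨⟨h1, h2⟩, hs⟩ | ⟨⟨h1, h2⟩, hs⟩ | ⟨⟨h1, h2⟩, hs⟩ |
    ⟨⟨h1, h2⟩, hs⟩
  · have := ucross_add_unest σ h2
    simp only [h1.not_gt, if_false] at hh
    simp [hs, Step.allowed, Step.mem_pairs]
    omega
  · simpa [hs, Step.allowed, Step.mem_pairs] using lcross_add_lnest σ h2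
  · simpa [hs, Step.allowed, Step.mem_pairs] using lcross_add_lnest σ h2
  · have := ucross_add_unest σ h2
    simp only [h1, if_true] at hh
    simp [hs, Step.allowed, Step.mem_pairs]
    omega
  · simp [hs, Step.allowed, hh, h1]

theorem next_stepAt (i : Fin n) : (stepAt σ i).next (height σ i) = height σ (i + 1) := by
  rw [height_eq, height_succ]
  rcases stepAt_cases σ i with ⟨⟨h1, h2⟩, hs⟩ | ⟨⟨h1, h2⟩, hs⟩ | ⟨⟨h1, h2⟩, hs⟩ | ⟨⟨h1, h2⟩, hs⟩ |
    ⟨⟨h1, h2⟩, hs⟩ <;> rw [hs] <;> grind [Step.next]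

/-- The history of a permutation. -/
def history : List Step := List.ofFn (stepAt σ)

theorem history_mem : history σ ∈ histories n 0 := by
  -- The last `m` steps form a history that starts at the height of the cut before them.
  have key : ∀ m k (hk : k + m = n),
      List.ofFn (fun i : Fin m => stepAt σ ⟨k + i, by omega⟩) ∈ histories m (height σ k) := by
    intro m
    induction m with
    | zero =>
      intro k hk
      have : height σ k = 0 := by
        rw [show k = n from hk]
        exact height_last σ
      simp [histories, this]
    | succ m ih =>
      intro k hk
      rw [List.ofFn_succ, histories, mem_biUnion]
      refine ⟨_, stepAt_mem_allowed σ ⟨k, by omega⟩, mem_image.2 ⟨_, ?_, rfl⟩⟩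
      have hnext := next_stepAt σ ⟨k, by omega⟩
      have hshift (i : Fin m) : k + (i.succ : ℕ) = k + 1 + i := by
        rw [Fin.val_succ]
        omega
      simp only [hshift] at hnext ⊢
      rw [hnext]
      exact ih (k + 1) (by omega)
  have := key n 0 (by simp)
  simpa [height_zero, history] using this

theorem weight_history {R : Type*} [CommRing R] (a b c d : ℕ → ℕ → R) (e : ℕ → R) :
    ((history σ).map (Step.weight a b c d e)).prod =
      (∏ i with IsCVal σ i, a (ucross i σ) (unest i σ)) *
      (∏ i with IsCPeak σ i, b (lcross i σ) (lnest i σ)) *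
      (∏ i with IsCDFall σ i, c (lcross i σ) (lnest i σ)) *
      (∏ i with IsCDRise σ i, d (ucross i σ) (unest i σ)) *
      (∏ i with IsFix σ i, e (lev i σ)) := by
  rw [history, List.map_ofFn, List.prod_ofFn]
  simp only [prod_filter, ← prod_mul_distrib]
  refine prod_congr rfl fun i _ => ?_
  simp only [Function.comp, IsCVal, IsCPeak, IsCDFall, IsCDRise, IsFix]
  rcases stepAt_cases σ i with ⟨⟨h1, h2⟩, hs⟩ | ⟨⟨h1, h2⟩, hs⟩ | ⟨⟨h1, h2⟩, hs⟩ | ⟨⟨h1, h2⟩, hs⟩ |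
    ⟨⟨h1, h2⟩, hs⟩ <;> rw [hs] <;> grind [Step.weight]

/-- The arcs going down are determined, from left to right, by the positions at which they start
and end and by the numbers of nestings: `σ k` is the value of a given rank among the values below
`k` that are not yet attained. -/
theorem eq_of_card_nesting_eq {α : Type*} [LinearOrder α] [Fintype α] {σ τ : Equiv.Perm α}
    (hval : ∀ v, v < σ⁻¹ v ↔ v < τ⁻¹ v) (hpos : ∀ k, σ k < k ↔ τ k < k)
    (hnest : ∀ k, σ k < k → #{l | k < l ∧ σ l < σ k} = #{l | k < l ∧ τ l < τ k}) (k : α) :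
    σ k < k → τ k = σ k := by
  -- By symmetry it suffices to exclude `σ k < τ k`, where `τ` would have the larger nesting number.
  have aux : ∀ (σ τ : Equiv.Perm α) (k : α), (∀ v, v < σ⁻¹ v ↔ v < τ⁻¹ v) → σ k < k →
      (∀ l < k, τ l < l → σ l = τ l) → σ k < τ k →
      #{l | k < l ∧ σ l < σ k} < #{l | k < l ∧ τ l < τ k} := by
    intro σ τ k hval hk ih hlt
    rw [← card_map σ.toEmbedding, ← card_map (s := filter (fun l => k < l ∧ τ l < τ k) _)
      τ.toEmbedding]
    have mem : ∀ v ≤ σ k, k ≤ σ⁻¹ v → v < τ k ∧ k < τ⁻¹ v := by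
      intro v hv hkv
      have h1 : v < τ⁻¹ v := (hval v).1 ((hv.trans_lt hk).trans_le hkv)
      refine ⟨hv.trans_lt hlt, lt_of_not_ge fun h => ?_⟩
      rcases h.lt_or_eq with h | h
      · have := Equiv.Perm.eq_inv_iff_eq.2
          ((ih _ h (by simpa using h1)).trans (τ.apply_symm_apply v))
        exact (this ▸ h).not_ge hkv
      · rw [Equiv.Perm.inv_eq_iff_eq] at h
        exact (h ▸ hv).not_gt hlt
    refine card_lt_card ((ssubset_iff_of_subset fun v hv => ?_).2 ⟨σ k, ?_, ?_⟩)
    · simp only [mem_map_equiv, mem_filter, mem_univ, true_and] at hv ⊢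
      have := mem v (by simpa using hv.2.le) hv.1.le
      exact ⟨this.2, by simpa using this.1⟩
    · simp only [mem_map_equiv, mem_filter, mem_univ, true_and]
      have := mem (σ k) le_rfl (by simp)
      exact ⟨this.2, by simpa using this.1⟩
    · simp
  induction k using WellFoundedLT.induction with
  | ind k ih =>
    intro hk
    rcases lt_trichotomy (σ k) (τ k) with h | h | h
    · exact absurd (hnest k hk)
        (aux σ τ k hval hk (fun l hl h' => (ih l hl ((hpos l).2 h')).symm) h).ne
    · exact h.symm
    · exact absurd (hnest k hk)
        (aux τ σ k (fun v => (hval v).symm) ((hpos k).1 hk) (fun l hl h' => ih l hl h') h).ne'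

theorem history_injective : Function.Injective (history (n := n)) := by
  intro σ τ h
  have hs (i : Fin n) : stepAt σ i = stepAt τ i := congrFun (List.ofFn_injective h) i
  have kinds (i : Fin n) : (σ i < i ↔ τ i < i) ∧ (i < σ i ↔ i < τ i) ∧ (i < σ⁻¹ i ↔ i < τ⁻¹ i) ∧
      (σ⁻¹ i < i ↔ τ⁻¹ i < i) ∧ (σ i < i → lnest i σ = lnest i τ) ∧
      (i < σ i → unest i σ = unest i τ) := by
    have h := hs i
    rcases stepAt_cases σ i with ⟨⟨h1, h2⟩, h3⟩ | ⟨⟨h1, h2⟩, h3⟩ | ⟨⟨h1, h2⟩, h3⟩ |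
      ⟨⟨h1, h2⟩, h3⟩ | ⟨⟨h1, h2⟩, h3⟩ <;>
    rcases stepAt_cases τ i with ⟨⟨h4, h5⟩, h6⟩ | ⟨⟨h4, h5⟩, h6⟩ | ⟨⟨h4, h5⟩, h6⟩ |
      ⟨⟨h4, h5⟩, h6⟩ | ⟨⟨h4, h5⟩, h6⟩ <;>
    rw [h3, h6] at h <;> grind
  have down (i : Fin n) (hi : σ i < i) : τ i = σ i := by
    refine eq_of_card_nesting_eq (fun v => (kinds v).2.2.1) (fun k => (kinds k).1)
      (fun k hk => ?_) i hi
    rw [← lnest_eq σ hk, ← lnest_eq τ ((kinds k).1.1 hk)]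
    exact (kinds k).2.2.2.2.1 hk
  -- Reversing the order exchanges the arcs going up with those going down.
  have up (i : Fin n) (hi : i < σ i) : τ i = σ i := by
    refine eq_of_card_nesting_eq (α := (Fin n)ᵒᵈ) (σ := σ) (τ := τ)
      (fun v => (kinds v).2.2.2.1) (fun k => (kinds k).2.1) (fun k hk => ?_) i hi
    have := (kinds k).2.2.2.2.2 hk
    rw [unest_eq σ hk, unest_eq τ ((kinds k).2.1.1 hk)] at this
    exact this
  ext i
  rcases lt_trichotomy (σ i) i with hi | hi | hi
  · rw [down i hi]
  · have h1 := (kinds i).1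
    have h2 := (kinds i).2.1
    have : τ i = i := le_antisymm (le_of_not_gt fun h => (h2.2 h).ne' hi)
      (le_of_not_gt fun h => (h1.2 h).ne hi)
    rw [hi, this]
  · rw [up i hi]

/-- Every Laguerre history comes from a permutation, because there are `n!` of both. -/
theorem image_history : univ.image (history (n := n)) = histories n 0 := by
  refine eq_of_subset_of_card_le (image_subset_iff.2 fun σ _ => history_mem σ) ?_
  rw [card_image_of_injective _ history_injective, card_histories, card_univ, Fintype.card_perm,
    Fintype.card_fin]

theorem Q_eq_motzkin {R : Type*} [CommRing R] (a b c d : ℕ → ℕ → R) (e : ℕ → R) (n : ℕ) :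
    Q a b c d e n = motzkin (fun n => starPred c n + starPred d n + e n)
      (fun n => starPred a (n + 1)) (starPred b) n 0 := by
  rw [← sum_histories, ← image_history, sum_image history_injective.injOn, Q]
  exact sum_congr rfl fun σ _ => (weight_history σ a b c d e).symm

end Encoding

end PermJFrac

theorem theorem2p9 {R : Type*} [CommRing R] (a b c d : ℕ → ℕ → R) (e : ℕ → R) :
    PermJFrac.IsJFraction
      (PowerSeries.mk fun n => PermJFrac.Q a b c d e n)
      (fun n => PermJFrac.starPred c n + PermJFrac.starPred d n + e n)
      (fun n => PermJFrac.starPred a n * PermJFrac.starPred b n) := by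
  simp only [PermJFrac.Q_eq_motzkin]
  exact PermJFrac.isJFraction_motzkin (by simp [PermJFrac.starPred]) fun _ => rfl
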